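/- For $t\in\mathbb{C}$ with $\mathrm{Re}\,t<0$ put $q=e^{t}$, where $q^{r}$ means $e^{rt}$ for rational $r$, and let $$\vartheta_2(q)=2\sum_{k\ge 0}q^{\frac12(k+\frac12)^2},\qquad \vartheta_3(q)=1+2\sum_{k\ge 1}q^{\frac{k^2}{2}},\qquad f(q)=1-24\sum_{k\ge1}\frac{kq^k}{1-q^k},$$ $$x(t)=\vartheta_3(q^8)^2,\quad y(t)=\vartheta_2(q^8)^2,\quad z(t)=\vartheta_2(q^4)^2,\quad w(t)=\tfrac13\left(f(q^4)-2f(q^8)+4f(q^{16})\right).$$ For $A=\begin{pmatrix}a&b\\c&d\end{pmatrix}\in\mathrm{SL}(2,\mathbb{C})$ put $$x^A(t)=\frac{1}{ct+d}\,x\!\left(\frac{at+b}{ct+d}\right),\qquad w^A(t)=\frac{1}{(ct+d)^2}\,w\!\left(\frac{at+b}{ct+d}\right)-\frac{c}{ct+d},$$ and define $y^A$, $z^A$ like $x^A$. Let $\kappa$ be a square root of $2\pi\mathsf{i}/4$, and for $\tau$ in the upper half-plane $\mathbb{H}$ put $x^\infty(\tau)=\kappa\,x(2\pi\mathsf{i}\tau/4)$,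 $y^\infty(\tau)=\kappa\,y(2\pi\mathsf{i}\tau/4)$, $z^\infty(\tau)=\kappa\,z(2\pi\mathsf{i}\tau/4)$, $w^\infty(\tau)=\kappa^2\,w(2\pi\mathsf{i}\tau/4)$. Fix $\tau_0\in\mathbb{H}$ and $\omega_0\in\mathbb{C}^*$, and let $D=\{\tau\in\mathbb{C} : |\tau|<|2\omega_0^2\,\mathrm{Im}\,\tau_0|\}$. Put $$\delta(\tau)=2\mathsf{i}\omega_0^2\,\mathrm{Im}(\tau_0)-\tau,\qquad g(\tau)=\frac{2\mathsf{i}\omega_0^2\tau_0\,\mathrm{Im}(\tau_0)-\bar\tau_0\tau}{\delta(\tau)},$$ $$x^{(\tau_0,\omega_0)}(\tau)=\frac{2\mathsf{i}\omega_0\mathrm{Im}(\tau_0)}{\delta(\tau)}\,x^\infty(g(\tau)),\qquad w^{(\tau_0,\omega_0)}(\tau)=\frac{(2\mathsf{i}\omega_0\mathrm{Im}(\tau_0))^2}{\delta(\tau)^2}\,w^\infty(g(\tau))+\frac{1}{\delta(\tau)},$$ and define $y^{(\tau_0,\omega_0)}$, $z^{(\tau_0,\omega_0)}$ like $x^{(\tau_0,\omega_0)}$.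 For $\tau\in D$ one has $\delta(\tau)\neq0$ and $g(\tau)\in\mathbb{H}$, so that these functions are defined on $D$, and the following hold. (i) On $D$ the functions $X=x^{(\tau_0,\omega_0)}$, $Y=y^{(\tau_0,\omega_0)}$, $W=w^{(\tau_0,\omega_0)}$ solve $$X'=X(2Y^2-X^2+W),\qquad Y'=Y(X^2+W),\qquad W'=W^2-X^4 .$$ (ii) $x^{(\tau_0,\omega_0)}$, $y^{(\tau_0,\omega_0)}$, $z^{(\tau_0,\omega_0)}$ and $w^{(\tau_0,\omega_0)}$ are holomorphic on $D$. (iii) The matrix $$A=\begin{pmatrix}\dfrac{\mathsf{i}\kappa\bar\tau_0}{2\omega_0\mathrm{Im}(\tau_0)} & \kappa\omega_0\tau_0\\[2ex] \dfrac{\mathsf{i}}{2\kappa\omega_0\mathrm{Im}(\tau_0)} & \dfrac{\omega_0}{\kappa}\end{pmatrix}$$ lies in $\mathrm{SL}(2,\mathbb{C})$, and $x^{(\tau_0,\omega_0)}=x^A$, $y^{(\tau_0,\omega_0)}=y^A$, $z^{(\tau_0,\omega_0)}=z^A$, $w^{(\tau_0,\omega_0)}=w^A$ on $D$. -/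

import Mathlib

noncomputable section

namespace ThetaCayley

/-! ### The series, as functions of `t` where `q = exp t`

A power `q ^ r` of `q = exp t` is `exp (r * t)`, for every rational exponent `r`; in particular the
value of a series at `q ^ m` is its value at the parameter `m * t`.
All series converge absolutely for `Re t < 0`, that is, for `|q| < 1`. -/

/-- `ϑ₂(q) = 2 ∑_{k ≥ 0} q ^ ((k + 1/2)² / 2)` at `q = exp t`. -/
def theta2 (t : ℂ) : ℂ :=
  2 * ∑' k : ℕ, Complex.exp (((k : ℂ) + 1 / 2) ^ 2 / 2 * t)

/-- `ϑ₃(q) = 1 + 2 ∑_{k ≥ 1} q ^ (k² / 2)` at `q = exp t`. -/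
def theta3 (t : ℂ) : ℂ :=
  1 + 2 * ∑' k : ℕ, Complex.exp (((k : ℂ) + 1) ^ 2 / 2 * t)

/-- The second Eisenstein series `f(q) = 1 - 24 ∑_{k ≥ 1} k q ^ k / (1 - q ^ k)` at `q = exp t`. -/
def eisF (t : ℂ) : ℂ :=
  1 - 24 * ∑' k : ℕ,
    ((k : ℂ) + 1) * Complex.exp (((k : ℂ) + 1) * t) / (1 - Complex.exp (((k : ℂ) + 1) * t))

/-- `x(q) = ϑ₃(q⁸)²` at `q = exp t`. -/
def x (t : ℂ) : ℂ := theta3 (8 * t) ^ 2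

/-- `y(q) = ϑ₂(q⁸)²` at `q = exp t`. -/
def y (t : ℂ) : ℂ := theta2 (8 * t) ^ 2

/-- `z(q) = ϑ₂(q⁴)²` at `q = exp t`. -/
def z (t : ℂ) : ℂ := theta2 (4 * t) ^ 2

/-- `w(q) = (f(q⁴) - 2 f(q⁸) + 4 f(q¹⁶)) / 3` at `q = exp t`. -/
def w (t : ℂ) : ℂ := 1 / 3 * (eisF (4 * t) - 2 * eisF (8 * t) + 4 * eisF (16 * t))

/-! ### The system of differential equations -/

/-- On the set `U`, the functions `X, Y, W` are complex differentiable and solve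
`X' = X (2 Y² - X² + W)`, `Y' = Y (X² + W)`, `W' = W² - X⁴`. -/
def IsSolutionOn (U : Set ℂ) (X Y W : ℂ → ℂ) : Prop :=
  ∀ t ∈ U,
    HasDerivAt X (X t * (2 * Y t ^ 2 - X t ^ 2 + W t)) t ∧
    HasDerivAt Y (Y t * (X t ^ 2 + W t)) t ∧
    HasDerivAt W (W t ^ 2 - X t ^ 4) t

/-! ### The action of `SL(2, ℂ)` -/

/-- `F^A(t) = F((a t + b) / (c t + d)) / (c t + d)`; the action on `x`, `y` and `z`. -/
def act (A : Matrix.SpecialLinearGroup (Fin 2) ℂ) (F : ℂ → ℂ) (t : ℂ) : ℂ :=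
  1 / (A 1 0 * t + A 1 1) * F ((A 0 0 * t + A 0 1) / (A 1 0 * t + A 1 1))

/-- `F^A(t) = F((a t + b) / (c t + d)) / (c t + d)² - c / (c t + d)`; the action on `w`. -/
def actW (A : Matrix.SpecialLinearGroup (Fin 2) ℂ) (F : ℂ → ℂ) (t : ℂ) : ℂ :=
  1 / (A 1 0 * t + A 1 1) ^ 2 * F ((A 0 0 * t + A 0 1) / (A 1 0 * t + A 1 1))
    - A 1 0 / (A 1 0 * t + A 1 1)

/-! ### The functions on the upper half-plane and their Cayley-type transforms -/

/-- `q(τ) = exp (2 π i τ / 4)`, that is, `t = 2 π i τ / 4`. -/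
def tOf (τ : ℂ) : ℂ := 2 * (Real.pi : ℂ) * Complex.I * τ / 4

def xInf (κ τ : ℂ) : ℂ := κ * x (tOf τ)

def yInf (κ τ : ℂ) : ℂ := κ * y (tOf τ)

def zInf (κ τ : ℂ) : ℂ := κ * z (tOf τ)

def wInf (κ τ : ℂ) : ℂ := κ ^ 2 * w (tOf τ)

/-- The denominator `2 i ω₀² Im τ₀ - τ`. -/
def den (τ₀ : UpperHalfPlane) (ω₀ τ : ℂ) : ℂ :=
  2 * Complex.I * ω₀ ^ 2 * (τ₀.im : ℂ) - τ

/-- The point `(2 i ω₀² τ₀ Im τ₀ - conj τ₀ * τ) / (2 i ω₀² Im τ₀ - τ)`. -/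
def cayleyPoint (τ₀ : UpperHalfPlane) (ω₀ τ : ℂ) : ℂ :=
  (2 * Complex.I * ω₀ ^ 2 * (τ₀ : ℂ) * (τ₀.im : ℂ) - (starRingEnd ℂ) (τ₀ : ℂ) * τ)
    / den τ₀ ω₀ τ

/-- The transform of `x^∞`, `y^∞` and `z^∞`. -/
def cayley (τ₀ : UpperHalfPlane) (ω₀ : ℂ) (F : ℂ → ℂ) (τ : ℂ) : ℂ :=
  2 * Complex.I * ω₀ * (τ₀.im : ℂ) / den τ₀ ω₀ τ * F (cayleyPoint τ₀ ω₀ τ)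

/-- The transform of `w^∞`. -/
def cayleyW (τ₀ : UpperHalfPlane) (ω₀ : ℂ) (F : ℂ → ℂ) (τ : ℂ) : ℂ :=
  (2 * Complex.I * ω₀ * (τ₀.im : ℂ)) ^ 2 / den τ₀ ω₀ τ ^ 2 * F (cayleyPoint τ₀ ω₀ τ)
    + 1 / den τ₀ ω₀ τ

/-- The disc `|τ| < |2 ω₀² Im τ₀|`. -/
def disc (τ₀ : UpperHalfPlane) (ω₀ : ℂ) : Set ℂ :=
  {τ : ℂ | ‖τ‖ < ‖2 * ω₀ ^ 2 * (τ₀.im : ℂ)‖}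

/-- The matrix `A`. -/
def matA (κ : ℂ) (τ₀ : UpperHalfPlane) (ω₀ : ℂ) : Matrix (Fin 2) (Fin 2) ℂ :=
  !![Complex.I * κ * (starRingEnd ℂ) (τ₀ : ℂ) / (2 * ω₀ * (τ₀.im : ℂ)), κ * ω₀ * (τ₀ : ℂ);
     Complex.I / (2 * κ * ω₀ * (τ₀.im : ℂ)), ω₀ / κ]

end ThetaCayley

end

/-!
The four functions are expressed through the period `T` with `q ^ 8 = exp (2 π i T)`: there
`x = θ₃(T)²`, `y = θ₂(T)²` and `w = (E₂(T/2) - 2 E₂(T) + 4 E₂(2T)) / 3`. The system is thereby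
reduced to four identities on the upper half-plane, between `E₂` and the fourth powers
`A₂, A₃, A₄` of the theta constants:

* `A₃ = A₂ + A₄` (`jacobi_identity`);
* the logarithmic derivatives of `A₂, A₃, A₄` (`deriv_theta_fourth_powers`);
* Ramanujan's equation for `E₂` (`deriv_e₂`), with `E₄` written as half of `A₂² + A₃² + A₄²`;
* `E₂(τ/2) + 4 E₂(2τ) - 4 E₂(τ) = A₄ - A₂` (`e₂_isogeny_relation`), which turns `w` into
  `(2 E₂ + A₄ - A₂) / 3`.

Each identity says that certain functions tending to zero at `i∞` vanish, and each is obtained from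
the absence of level one cusp forms of weight less than twelve. A function which
`τ ↦ -1/τ` and `τ ↦ τ + 1` multiply by a common sign (besides the automorphy factor) has a square of
level one (`eq_zero_of_level_one_character`). The second and the fourth identity are parts
of triples which the two generators permute up to a common sign. In such a triple `a, b, c` both the
sum and the sum of squares vanish, so `a² + ab + b² = 0`; this quadratic form splits over `ℂ`, the
holomorphic functions on the upper half-plane form a domain, and the translation `τ ↦ τ + 1`, which
exchanges `a` and `b`, excludes a nonzero solution (`eq_zero_of_permuted_triple`).

The theta constants need not be known to have no zeros: after multiplication by a cube of a
theta constant, the equation for that constant itself follows in the same domain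
(`four_mul_deriv_eq`). Finally the group `SL(2, ℂ)` preserves the solutions
(`isSolutionOn_act`), and since `κ² = 2 π i / 4` the Cayley transform is the action of the matrix
`A`, which carries the disc into the half-plane `Re t < 0` (`matA_moebius`, `im_cayleyPoint_pos`).
-/

namespace ThetaCayley

open Complex Filter Topology
open UpperHalfPlane hiding I im
open scoped ModularForm MatrixGroups Real

/-! ### Level one vanishing criteria -/

theorem ne_zero_of_im_pos {τ : ℂ} (hτ : 0 < τ.im) : τ ≠ 0 := by
  rintro rfl; simp at hτ

theorem im_neg_one_div_pos {τ : ℂ} (hτ : 0 < τ.im) : 0 < (-1 / τ).im := by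
  have h := ne_zero_of_im_pos hτ
  rw [neg_div, one_div, neg_im, inv_im, neg_div, neg_neg]
  exact div_pos hτ (normSq_pos.mpr h)

/-- A holomorphic function of level one and weight `k < 12` that tends to zero at `i∞` vanishes: it is
a cusp form, and there are none of weight less than twelve. -/
theorem eq_zero_of_level_one {f : ℂ → ℂ} {k : ℕ} (hk : k < 12)
    (hf : DifferentiableOn ℂ f {τ | 0 < τ.im})
    (hS : ∀ τ : ℂ, 0 < τ.im → f (-1 / τ) = τ ^ k * f τ)
    (hT : ∀ τ : ℂ, 0 < τ.im → f (τ + 1) = f τ)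
    (h0 : Tendsto f (comap im atTop) (𝓝 0)) {τ : ℂ} (hτ : 0 < τ.im) : f τ = 0 := by
  have slS : (fun z : ℍ ↦ f z) ∣[(k : ℤ)] ModularGroup.S = fun z : ℍ ↦ f z := by
    ext z
    have hz : (z : ℂ) ≠ 0 := z.ne_zero
    have := hS z z.im_pos
    rw [neg_div, one_div, ← inv_neg] at this
    rw [SlashInvariantForm.slash_S_apply]
    change f (-(z : ℂ))⁻¹ * _ = _
    rw [this, zpow_neg, zpow_natCast]
    field_simp
  have slT : (fun z : ℍ ↦ f z) ∣[(k : ℤ)] ModularGroup.T = fun z : ℍ ↦ f z := by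
    ext z
    have := hT z z.im_pos
    rw [ModularForm.SL_slash_apply, modular_T_smul]
    have hd : denom (ModularGroup.T : SL(2, ℤ)) z = 1 := by
      rw [ModularGroup.denom_apply]
      simp [ModularGroup.T]
    rw [hd, one_zpow, mul_one, coe_vadd]
    simpa [add_comm] using this
  have inv := SlashInvariantForm.slash_action_generators_SL2Z slS slT
  have h0' : IsZeroAtImInfty (fun z : ℍ ↦ f z) := h0.comp tendsto_coe_atImInfty
  let F : CuspForm 𝒮ℒ (k : ℤ) :=
    { toFun := fun z ↦ f z
      slash_action_eq' := by
        rintro A ⟨A, rfl⟩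
        exact inv A
      holo' := by
        rw [UpperHalfPlane.mdifferentiable_iff]
        refine hf.congr fun z hz ↦ ?_
        simp [ofComplex_apply_of_im_pos hz]
      zero_at_cusps' := by
        intro c hc
        rw [Subgroup.IsArithmetic.isCusp_iff_isCusp_SL2Z] at hc
        rw [OnePoint.isZeroAt_iff_forall_SL2Z hc]
        intro γ _
        rw [inv γ]
        exact h0' }
  have hF : F = 0 := rank_zero_iff_forall_zero.mp
    (CuspForm.rank_eq_zero_of_weight_lt_twelve (by exact_mod_cast hk)) F
  exact congrArg (fun G : CuspForm 𝒮ℒ (k : ℤ) ↦ G ⟨τ, hτ⟩) hF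

/-- The same with a sign `ε` in both transformation laws; the square is of level one. -/
theorem eq_zero_of_level_one_character {f : ℂ → ℂ} {k : ℕ} {ε : ℂ} (hk : k < 6) (hε : ε ^ 2 = 1)
    (hf : DifferentiableOn ℂ f {τ | 0 < τ.im})
    (hS : ∀ τ : ℂ, 0 < τ.im → f (-1 / τ) = ε * τ ^ k * f τ)
    (hT : ∀ τ : ℂ, 0 < τ.im → f (τ + 1) = ε * f τ)
    (h0 : Tendsto f (comap im atTop) (𝓝 0)) {τ : ℂ} (hτ : 0 < τ.im) : f τ = 0 := by
  have := eq_zero_of_level_one (f := fun τ ↦ f τ ^ 2) (k := k * 2) (by omega) (hf.pow 2)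
    (fun τ hτ ↦ by
      simp only [hS τ hτ, mul_pow, hε, pow_mul, one_mul])
    (fun τ hτ ↦ by simp only [hT τ hτ, mul_pow, hε, one_mul])
    (by simpa using h0.pow 2) hτ
  exact pow_eq_zero_iff (two_ne_zero) |>.mp this

theorem isPreconnected_im_pos : IsPreconnected {τ : ℂ | 0 < τ.im} :=
  (convex_halfSpace_im_gt 0).isPreconnected

theorem isOpen_im_pos : IsOpen {τ : ℂ | 0 < τ.im} := isOpen_upperHalfPlaneSet

theorem im_add_one_pos {τ : ℂ} (hτ : 0 < τ.im) : 0 < (τ + 1).im := by simpa using hτ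

/-- Three functions tending to zero at `i∞` vanish if, up to a common sign `ε`, the transformation
`τ ↦ -1/τ` fixes `a` and exchanges `b, c`, while `τ ↦ τ + 1` fixes `c` and exchanges `a, b`. -/
theorem eq_zero_of_permuted_triple {a b c : ℂ → ℂ} {k : ℕ} {ε : ℂ} (hk : k < 6) (hε : ε ^ 2 = 1)
    (ha : DifferentiableOn ℂ a {τ | 0 < τ.im}) (hb : DifferentiableOn ℂ b {τ | 0 < τ.im})
    (hc : DifferentiableOn ℂ c {τ | 0 < τ.im})
    (haS : ∀ τ : ℂ, 0 < τ.im → a (-1 / τ) = ε * τ ^ k * a τ)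
    (hbS : ∀ τ : ℂ, 0 < τ.im → b (-1 / τ) = ε * τ ^ k * c τ)
    (hcS : ∀ τ : ℂ, 0 < τ.im → c (-1 / τ) = ε * τ ^ k * b τ)
    (haT : ∀ τ : ℂ, 0 < τ.im → a (τ + 1) = ε * b τ)
    (hbT : ∀ τ : ℂ, 0 < τ.im → b (τ + 1) = ε * a τ)
    (hcT : ∀ τ : ℂ, 0 < τ.im → c (τ + 1) = ε * c τ)
    (ha0 : Tendsto a (comap im atTop) (𝓝 0)) (hb0 : Tendsto b (comap im atTop) (𝓝 0))
    (hc0 : Tendsto c (comap im atTop) (𝓝 0)) {τ : ℂ} (hτ : 0 < τ.im) :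
    a τ = 0 ∧ b τ = 0 ∧ c τ = 0 := by
  have hε0 : ε ≠ 0 := by rintro rfl; norm_num at hε
  have hsum : ∀ τ : ℂ, 0 < τ.im → a τ + b τ + c τ = 0 := fun τ hτ ↦
    eq_zero_of_level_one_character (f := fun τ ↦ a τ + b τ + c τ) hk hε ((ha.add hb).add hc)
      (fun τ hτ ↦ by simp only [haS τ hτ, hbS τ hτ, hcS τ hτ]; ring)
      (fun τ hτ ↦ by simp only [haT τ hτ, hbT τ hτ, hcT τ hτ]; ring)
      (by simpa using (ha0.add hb0).add hc0) hτ
  have hsq : ∀ τ : ℂ, 0 < τ.im → a τ ^ 2 + b τ ^ 2 + c τ ^ 2 = 0 := fun τ hτ ↦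
    eq_zero_of_level_one (f := fun τ ↦ a τ ^ 2 + b τ ^ 2 + c τ ^ 2) (k := k * 2) (by omega)
      (((ha.pow 2).add (hb.pow 2)).add (hc.pow 2))
      (fun τ hτ ↦ by simp only [haS τ hτ, hbS τ hτ, hcS τ hτ, mul_pow, hε, pow_mul]; ring)
      (fun τ hτ ↦ by simp only [haT τ hτ, hbT τ hτ, hcT τ hτ, mul_pow, hε]; ring)
      (by simpa using ((ha0.pow 2).add (hb0.pow 2)).add (hc0.pow 2)) hτ
  -- Eliminating `c` leaves `a² + ab + b² = 0`; with `ω² = -3` this form splits into the linear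
  -- factors `2a + (1 ± ω)b`, up to the constant `4`.
  obtain ⟨ω, hω⟩ : ∃ ω : ℂ, ω ^ 2 = -3 := IsAlgClosed.exists_pow_nat_eq _ two_pos
  have key : ∀ s : ℂ, s ^ 2 = -3 → (∀ τ : ℂ, 0 < τ.im → 2 * a τ + (1 + s) * b τ = 0) →
      ∀ τ : ℂ, 0 < τ.im → a τ = 0 ∧ b τ = 0 ∧ c τ = 0 := by
    intro s hs h τ hτ
    have h1 := h τ hτ
    have h2 := h (τ + 1) (im_add_one_pos hτ)
    rw [haT τ hτ, hbT τ hτ] at h2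
    have h2' : 2 * b τ + (1 + s) * a τ = 0 := by
      refine (mul_eq_zero.mp (?_ : ε * (2 * b τ + (1 + s) * a τ) = 0)).resolve_left hε0
      linear_combination h2
    -- The determinant of the two linear relations is `6 - 2s`, whose norm form is `48`.
    have hb' : b τ = 0 := by
      linear_combination ((6 + 2 * s) / 48) * (2 * h2' - (1 + s) * h1) +
        (b τ * (2 * s + 10) / 48) * hs
    have ha' : a τ = 0 := by
      rw [hb'] at h1
      linear_combination h1 / 2
    refine ⟨ha', hb', ?_⟩
    have := hsum τ hτ
    rw [ha', hb'] at this
    linear_combination this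
  have hprod : ∀ τ ∈ {τ : ℂ | 0 < τ.im},
      (2 * a τ + (1 + ω) * b τ) * (2 * a τ + (1 + -ω) * b τ) = 0 := by
    intro τ hτ
    linear_combination 2 * hsq τ hτ - 2 * (c τ - a τ - b τ) * hsum τ hτ - b τ ^ 2 * hω
  rcases AnalyticOnNhd.eq_zero_or_eq_zero_of_mul_eq_zero
    (((ha.const_mul 2).add (hb.const_mul (1 + ω))).analyticOnNhd isOpen_im_pos)
    (((ha.const_mul 2).add (hb.const_mul (1 + -ω))).analyticOnNhd isOpen_im_pos)
    hprod isPreconnected_im_pos with h | h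
  · exact key ω hω h τ hτ
  · exact key (-ω) (by rw [neg_sq, hω]) h τ hτ

/-! ### Derivatives of functions on the upper half-plane -/

/-- Cauchy's estimate on discs of radius one. -/
theorem tendsto_deriv_zero_of_tendsto {f : ℂ → ℂ} {l : ℂ}
    (hf : DifferentiableOn ℂ f {τ | 0 < τ.im}) (h : Tendsto f (comap im atTop) (𝓝 l)) :
    Tendsto (deriv f) (comap im atTop) (𝓝 0) := by
  rw [Metric.tendsto_nhds] at h ⊢
  intro ε hε
  have h' := h (ε / 2) (by positivity)
  rw [eventually_comap, eventually_atTop] at h' ⊢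
  obtain ⟨M, hM⟩ := h'
  refine ⟨max M 0 + 2, fun y hy τ hτ ↦ ?_⟩
  have hball : ∀ z ∈ Metric.closedBall τ 1, max M 0 < z.im := by
    intro z hz
    have h1 : |(z - τ).im| ≤ 1 := (abs_im_le_norm _).trans (by simpa [dist_eq_norm] using hz)
    rw [sub_im] at h1
    have := (abs_le.mp h1).1
    linarith
  have hd : DiffContOnCl ℂ (fun z ↦ f z - l) (Metric.ball τ 1) := by
    refine DifferentiableOn.diffContOnCl ?_
    rw [closure_ball _ one_ne_zero]
    exact (hf.mono fun z hz ↦ (le_max_right M 0).trans_lt (hball z hz)).sub_const l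
  have := norm_deriv_le_of_forall_mem_sphere_norm_le (C := ε / 2) one_pos hd fun z hz ↦ by
    have hz' := hball z (Metric.sphere_subset_closedBall hz)
    have := hM z.im ((le_max_left M 0).trans hz'.le) z rfl
    rw [dist_eq_norm] at this
    exact this.le
  rw [deriv_sub_const] at this
  rw [dist_zero_right]
  linarith

theorem differentiableOn_deriv {f : ℂ → ℂ} (hf : DifferentiableOn ℂ f {τ | 0 < τ.im}) :
    DifferentiableOn ℂ (deriv f) {τ | 0 < τ.im} := hf.deriv isOpen_im_pos

theorem hasDerivAt_of_differentiableOn {f : ℂ → ℂ} (hf : DifferentiableOn ℂ f {τ | 0 < τ.im})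
    {τ : ℂ} (hτ : 0 < τ.im) : HasDerivAt f (deriv f τ) τ :=
  (hf.differentiableAt (isOpen_im_pos.mem_nhds hτ)).hasDerivAt

theorem deriv_eq_of_eq_on {f g : ℂ → ℂ} (h : ∀ τ : ℂ, 0 < τ.im → f τ = g τ)
    {τ : ℂ} (hτ : 0 < τ.im) : deriv f τ = deriv g τ :=
  Filter.EventuallyEq.deriv_eq <| by
    filter_upwards [isOpen_im_pos.mem_nhds hτ] with z hz using h z hz

theorem deriv_add_one {f g : ℂ → ℂ} {ε : ℂ} (h : ∀ τ : ℂ, 0 < τ.im → f (τ + 1) = ε * g τ)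
    {τ : ℂ} (hτ : 0 < τ.im) : deriv f (τ + 1) = ε * deriv g τ := by
  rw [← deriv_comp_add_const, deriv_eq_of_eq_on h hτ, deriv_const_mul_field]

theorem hasDerivAt_neg_one_div {τ : ℂ} (hτ : τ ≠ 0) :
    HasDerivAt (fun z : ℂ ↦ -1 / z) (1 / τ ^ 2) τ := by
  have := (hasDerivAt_inv hτ).neg
  refine (this.congr_of_eventuallyEq (.of_forall fun z ↦ ?_)).congr_deriv ?_
  · simp [neg_div]
  · simp

/-- The derivative of `f` at `-1/τ`, from a formula `h` for `f (-1/τ)`. -/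
theorem deriv_neg_one_div {f h : ℂ → ℂ} (hf : DifferentiableOn ℂ f {τ | 0 < τ.im})
    (hfh : ∀ τ : ℂ, 0 < τ.im → f (-1 / τ) = h τ) {τ h' : ℂ} (hτ : 0 < τ.im)
    (hh : HasDerivAt h h' τ) : deriv f (-1 / τ) = τ ^ 2 * h' := by
  have h0 := ne_zero_of_im_pos hτ
  have h1 := (hasDerivAt_of_differentiableOn hf (im_neg_one_div_pos hτ)).comp τ
    (hasDerivAt_neg_one_div h0)
  have h2 : f ∘ (fun z ↦ -1 / z) =ᶠ[𝓝 τ] h := by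
    filter_upwards [isOpen_im_pos.mem_nhds hτ] with z hz using hfh z hz
  rw [← (h1.congr_of_eventuallyEq h2.symm).unique hh]
  field_simp

/-! ### Theta constants and their fourth powers -/

theorem theta3_eq_jacobiTheta {τ : ℂ} (hτ : 0 < τ.im) : theta3 (2 * π * I * τ) = jacobiTheta τ := by
  rw [theta3, jacobiTheta_eq_tsum_nat hτ]
  congr 3
  ext k
  congr 1
  ring

theorem theta2_eq_jacobiTheta₂ {τ : ℂ} (hτ : 0 < τ.im) :
    theta2 (2 * π * I * τ) = cexp (π * I * τ / 4) * jacobiTheta₂ (τ / 2) τ := by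
  have hs := hasSum_jacobiTheta₂_term (τ / 2) hτ
  have hsym : ∀ k : ℕ, jacobiTheta₂_term (-((k : ℤ) + 1)) (τ / 2) τ =
      jacobiTheta₂_term k (τ / 2) τ := by
    intro k
    simp only [jacobiTheta₂_term]
    congr 1
    push_cast
    ring
  have h1 : Summable fun k : ℕ ↦ jacobiTheta₂_term k (τ / 2) τ :=
    hs.summable.comp_injective Nat.cast_injective
  have h2 : jacobiTheta₂ (τ / 2) τ = 2 * ∑' k : ℕ, jacobiTheta₂_term k (τ / 2) τ := by
    rw [jacobiTheta₂, tsum_of_nat_of_neg_add_one (f := fun n : ℤ ↦ jacobiTheta₂_term n (τ / 2) τ) h1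
      (h1.congr fun k ↦ (hsym k).symm), two_mul, tsum_congr hsym]
  rw [h2, theta2, mul_left_comm, ← tsum_mul_left (a := cexp (π * I * τ / 4))]
  congr 1
  refine tsum_congr fun k ↦ ?_
  rw [jacobiTheta₂_term, ← Complex.exp_add]
  congr 1
  push_cast
  ring

/-- The fourth power of `θ₂`, as a function of the period `τ` with `q = exp (2 π i τ)`. -/
noncomputable def A₂ (τ : ℂ) : ℂ := theta2 (2 * π * I * τ) ^ 4

/-- The fourth power of `θ₃`. -/
noncomputable def A₃ (τ : ℂ) : ℂ := jacobiTheta τ ^ 4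

/-- The fourth power of `θ₄(τ) = θ₃(τ + 1)`. -/
noncomputable def A₄ (τ : ℂ) : ℂ := jacobiTheta (τ + 1) ^ 4

theorem differentiableOn_jacobiTheta : DifferentiableOn ℂ jacobiTheta {τ | 0 < τ.im} :=
  fun _ hτ ↦ (differentiableAt_jacobiTheta hτ).differentiableWithinAt

theorem differentiableOn_theta2 :
    DifferentiableOn ℂ (fun τ ↦ theta2 (2 * π * I * τ)) {τ | 0 < τ.im} := by
  refine DifferentiableOn.congr (f := fun τ ↦ cexp (π * I * τ / 4) * jacobiTheta₂ (τ / 2) τ) ?_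
    fun τ hτ ↦ theta2_eq_jacobiTheta₂ hτ
  intro τ hτ
  have h : DifferentiableAt ℂ (fun τ : ℂ ↦ jacobiTheta₂ (τ / 2) τ) τ :=
    DifferentiableAt.comp (g := fun p : ℂ × ℂ ↦ jacobiTheta₂ p.1 p.2) (f := fun τ : ℂ ↦ (τ / 2, τ)) τ
      (hasFDerivAt_jacobiTheta₂ (τ / 2) hτ).differentiableAt (by fun_prop)
  exact (DifferentiableAt.mul (by fun_prop) h).differentiableWithinAt

theorem differentiableOn_A₂ : DifferentiableOn ℂ A₂ {τ | 0 < τ.im} := differentiableOn_theta2.pow 4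

theorem differentiableOn_A₃ : DifferentiableOn ℂ A₃ {τ | 0 < τ.im} :=
  differentiableOn_jacobiTheta.pow 4

theorem differentiableOn_A₄ : DifferentiableOn ℂ A₄ {τ | 0 < τ.im} :=
  (differentiableOn_jacobiTheta.comp (by fun_prop) fun _ hτ ↦ im_add_one_pos hτ).pow 4

theorem A₃_add_one (τ : ℂ) : A₃ (τ + 1) = A₄ τ := rfl

theorem A₄_add_one (τ : ℂ) : A₄ (τ + 1) = A₃ τ := by
  rw [A₄, A₃, show τ + 1 + 1 = 2 + τ by ring, jacobiTheta_two_add]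

theorem A₂_add_one {τ : ℂ} (hτ : 0 < τ.im) : A₂ (τ + 1) = -A₂ τ := by
  have h : jacobiTheta₂ ((τ + 1) / 2) (τ + 1) = jacobiTheta₂ (τ / 2) τ := by
    refine tsum_congr fun n ↦ ?_
    obtain ⟨m, hm⟩ := Int.even_mul_succ_self n
    have hm' : (n : ℂ) * (n + 1) = m + m := by exact_mod_cast congrArg (Int.cast (R := ℂ)) hm
    rw [jacobiTheta₂_term, jacobiTheta₂_term,
      show 2 * π * I * n * ((τ + 1) / 2) + π * I * n ^ 2 * (τ + 1) =
        (2 * π * I * n * (τ / 2) + π * I * n ^ 2 * τ) + m * (2 * π * I) by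
          linear_combination π * I * hm',
      Complex.exp_add, Complex.exp_int_mul_two_pi_mul_I, mul_one]
  rw [A₂, A₂, theta2_eq_jacobiTheta₂ (im_add_one_pos hτ), theta2_eq_jacobiTheta₂ hτ, h, mul_pow,
    mul_pow, ← Complex.exp_nat_mul, ← Complex.exp_nat_mul,
    show ((4 : ℕ) : ℂ) * (π * I * (τ + 1) / 4) = ((4 : ℕ) : ℂ) * (π * I * τ / 4) + π * I by
      push_cast; ring, Complex.exp_add, Complex.exp_pi_mul_I]
  ring

theorem cpow_half_pow_four (τ : ℂ) : ((-I * τ) ^ (1 / 2 : ℂ)) ^ 4 = -τ ^ 2 := by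
  rw [← cpow_nat_mul, show ((4 : ℕ) : ℂ) * (1 / 2) = (2 : ℕ) by norm_num, cpow_natCast, mul_pow,
    neg_sq, I_sq]
  ring

theorem A₃_neg_one_div {τ : ℂ} (hτ : 0 < τ.im) : A₃ (-1 / τ) = -τ ^ 2 * A₃ τ := by
  have h0 := ne_zero_of_im_pos hτ
  have h := congrArg (· ^ 4) (jacobiTheta₂_functional_equation 0 τ)
  simp only [zero_div, ← jacobiTheta_eq_jacobiTheta₂, mul_pow, div_pow, cpow_half_pow_four] at h
  rw [A₃, A₃, h]
  simp
  field_simp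

theorem A₂_neg_one_div {τ : ℂ} (hτ : 0 < τ.im) : A₂ (-1 / τ) = -τ ^ 2 * A₄ τ := by
  have h0 := ne_zero_of_im_pos hτ
  have h4 : jacobiTheta (τ + 1) = jacobiTheta₂ (1 / 2) τ := by
    refine tsum_congr fun n ↦ ?_
    obtain ⟨m, hm⟩ := Int.even_mul_pred_self n
    have hm' : (n : ℂ) * (n - 1) = m + m := by exact_mod_cast congrArg (Int.cast (R := ℂ)) hm
    rw [jacobiTheta₂_term,
      show π * I * (n : ℂ) ^ 2 * (τ + 1) =
        (2 * π * I * n * (1 / 2) + π * I * n ^ 2 * τ) + m * (2 * π * I) by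
          linear_combination π * I * hm',
      Complex.exp_add (2 * π * I * n * (1 / 2) + π * I * n ^ 2 * τ),
      Complex.exp_int_mul_two_pi_mul_I, mul_one]
  have h := jacobiTheta₂_functional_equation (1 / 2) τ
  have harg : (1 / 2 / τ : ℂ) = -(-1 / τ / 2) := by field_simp
  rw [harg, jacobiTheta₂_neg_left, ← h4] at h
  have he : cexp (-π * I * (1 / 2) ^ 2 / τ) = cexp (π * I * (-1 / τ) / 4) := by
    congr 1; field_simp; norm_num
  rw [he, mul_assoc, ← theta2_eq_jacobiTheta₂ (im_neg_one_div_pos hτ)] at h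
  have h' := congrArg (· ^ 4) h
  simp only [mul_pow, div_pow, cpow_half_pow_four] at h'
  rw [A₂, A₄, h']
  field_simp

theorem A₄_neg_one_div {τ : ℂ} (hτ : 0 < τ.im) : A₄ (-1 / τ) = -τ ^ 2 * A₂ τ := by
  have h0 := ne_zero_of_im_pos hτ
  have h := A₂_neg_one_div (im_neg_one_div_pos hτ)
  rw [show -1 / (-1 / τ) = τ by field_simp] at h
  rw [h]
  field_simp

theorem tendsto_jacobiTheta : Tendsto jacobiTheta (comap im atTop) (𝓝 1) := by
  have h : Tendsto (fun τ : ℂ ↦ rexp (-π * τ.im)) (comap im atTop) (𝓝 0) := by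
    have : Tendsto (fun y : ℝ ↦ rexp (-π * y)) atTop (𝓝 0) :=
      Real.tendsto_exp_atBot.comp (tendsto_id.const_mul_atTop_of_neg (neg_lt_zero.mpr Real.pi_pos))
    exact this.comp tendsto_comap
  have := (isBigO_at_im_infty_jacobiTheta_sub_one.trans_tendsto h).add_const 1
  simpa using this

theorem tendsto_add_one : Tendsto (fun τ : ℂ ↦ τ + 1) (comap im atTop) (comap im atTop) := by
  rw [tendsto_comap_iff]
  exact tendsto_comap.congr fun τ ↦ by simp

theorem tendsto_A₃ : Tendsto A₃ (comap im atTop) (𝓝 1) := by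
  simpa using! tendsto_jacobiTheta.pow 4

theorem tendsto_A₄ : Tendsto A₄ (comap im atTop) (𝓝 1) := tendsto_A₃.comp tendsto_add_one

/-- The exponent satisfies `(k + 1/2)² Im τ ≥ k + Im τ / 4` once `Im τ ≥ 1`. -/
theorem norm_theta2_le {τ : ℂ} (hτ : 1 ≤ τ.im) :
    ‖theta2 (2 * π * I * τ)‖ ≤ 2 * ∑' k : ℕ, rexp (-π) ^ k * rexp (-π * τ.im / 4) := by
  have hlt : rexp (-π) < 1 := Real.exp_lt_one_iff.mpr (neg_lt_zero.mpr Real.pi_pos)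
  have hsum : Summable fun k : ℕ ↦ rexp (-π) ^ k * rexp (-π * τ.im / 4) :=
    (summable_geometric_of_lt_one (Real.exp_pos _).le hlt).mul_right _
  rw [theta2, norm_mul, Complex.norm_ofNat]
  refine mul_le_mul_of_nonneg_left (tsum_of_norm_bounded hsum.hasSum fun k ↦ ?_) zero_le_two
  rw [Complex.norm_exp, ← Real.exp_nat_mul, ← Real.exp_add, Real.exp_le_exp]
  have : (((k : ℂ) + 1 / 2) ^ 2 / 2 * (2 * π * I * τ)).re = -(π * ((k : ℝ) + 1 / 2) ^ 2 * τ.im) := by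
    rw [show ((k : ℂ) + 1 / 2) ^ 2 / 2 * (2 * π * I * τ) =
      ((π * ((k : ℝ) + 1 / 2) ^ 2 : ℝ) : ℂ) * (τ * I) by push_cast; ring, re_ofReal_mul, mul_I_re]
    ring
  rw [this]
  have hk : (0 : ℝ) ≤ k := Nat.cast_nonneg k
  have h1 : (0 : ℝ) ≤ π * ((k : ℝ) * (τ.im - 1)) :=
    mul_nonneg Real.pi_pos.le (mul_nonneg hk (by linarith))
  have h2 : (0 : ℝ) ≤ π * ((k : ℝ) ^ 2 * τ.im) :=
    mul_nonneg Real.pi_pos.le (mul_nonneg (sq_nonneg _) (by linarith))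
  nlinarith

theorem tendsto_A₂ : Tendsto A₂ (comap im atTop) (𝓝 0) := by
  have h : Tendsto (fun τ : ℂ ↦ 2 * ∑' k : ℕ, rexp (-π) ^ k * rexp (-π * τ.im / 4))
      (comap im atTop) (𝓝 0) := by
    have h1 : Tendsto (fun y : ℝ ↦ rexp (-π * y / 4)) atTop (𝓝 0) := by
      refine Real.tendsto_exp_atBot.comp (Tendsto.congr (fun y ↦ ?_)
        (tendsto_id.const_mul_atTop_of_neg (r := -π / 4) (by linarith [Real.pi_pos])))
      simp; ring
    have h2 := ((h1.comp (tendsto_comap (f := im))).const_mul (∑' k : ℕ, rexp (-π) ^ k)).const_mul 2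
    simpa only [mul_zero, Function.comp_def, tsum_mul_right] using h2
  have h0 : Tendsto (fun τ ↦ theta2 (2 * π * I * τ)) (comap im atTop) (𝓝 0) := by
    refine squeeze_zero_norm' ?_ h
    filter_upwards [preimage_mem_comap (Ici_mem_atTop (1 : ℝ))] with τ hτ using norm_theta2_le hτ
  simpa using! h0.pow 4

/-! ### The Eisenstein series of weight two -/

/-- The weight two Eisenstein series as a function on `ℂ`; only its values on the upper
half-plane matter. -/
noncomputable def e₂ (τ : ℂ) : ℂ := EisensteinSeries.E2 (ofComplex τ)

theorem e₂_apply {τ : ℂ} (hτ : 0 < τ.im) : e₂ τ = EisensteinSeries.E2 ⟨τ, hτ⟩ := by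
  rw [e₂, ofComplex_apply_of_im_pos hτ]

theorem eisF_eq_e₂ {τ : ℂ} (hτ : 0 < τ.im) : eisF (2 * π * I * τ) = e₂ τ := by
  have hq := norm_exp_two_pi_I_lt_one ⟨τ, hτ⟩
  have h := tsum_pow_div_one_sub_eq_tsum_sigma hq 1
  rw [e₂_apply hτ, EisensteinSeries.E2_eq_tsum_cexp, eisF, ← h,
    tsum_pnat_eq_tsum_succ (f := fun n : ℕ ↦ (n : ℂ) ^ 1 * cexp (2 * π * I * τ) ^ n /
      (1 - cexp (2 * π * I * τ) ^ n))]
  congr 3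
  ext k
  rw [← Complex.exp_nat_mul]
  push_cast
  rw [pow_one]

theorem differentiableOn_e₂ : DifferentiableOn ℂ e₂ {τ | 0 < τ.im} :=
  UpperHalfPlane.mdifferentiable_iff.mp E2_mdifferentiable

theorem e₂_add_one {τ : ℂ} (hτ : 0 < τ.im) : e₂ (τ + 1) = e₂ τ := by
  rw [← eisF_eq_e₂ hτ, ← eisF_eq_e₂ (im_add_one_pos hτ), eisF, eisF]
  congr 3
  ext k
  have : cexp (((k : ℂ) + 1) * (2 * π * I * (τ + 1))) = cexp (((k : ℂ) + 1) * (2 * π * I * τ)) := by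
    rw [show ((k : ℂ) + 1) * (2 * π * I * (τ + 1)) =
      ((k : ℂ) + 1) * (2 * π * I * τ) + ((k + 1 : ℕ) : ℂ) * (2 * π * I) by push_cast; ring,
      Complex.exp_add, Complex.exp_nat_mul_two_pi_mul_I, mul_one]
  rw [this]

theorem e₂_neg_one_div {τ : ℂ} (hτ : 0 < τ.im) :
    e₂ (-1 / τ) = τ ^ 2 * e₂ τ + 12 * τ / (2 * π * I) := by
  have h0 := ne_zero_of_im_pos hτ
  have h := EisensteinSeries.G2_S_transform ⟨τ, hτ⟩
  have hS : (ModularGroup.S • (⟨τ, hτ⟩ : ℍ)) = ⟨-1 / τ, im_neg_one_div_pos hτ⟩ := by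
    rw [modular_S_smul]
    ext
    simp [neg_div]
  rw [hS] at h
  rw [e₂_apply hτ, e₂_apply (im_neg_one_div_pos hτ), EisensteinSeries.E2, Pi.smul_apply,
    Pi.smul_apply, h, riemannZeta_two]
  have hpi : (π : ℂ) ≠ 0 := by exact_mod_cast Real.pi_ne_zero
  simp only [smul_eq_mul]
  field_simp
  linear_combination (-12 * π * τ) * I_sq

theorem tendsto_e₂ : Tendsto e₂ (comap im atTop) (𝓝 1) := by
  have h : Tendsto EisensteinSeries.E2 atImInfty (𝓝 1) := by
    -- The quotient `(E₂ - 1) / q` has a `q`-expansion too, hence is bounded at `i∞`.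
    let q : ℍ → ℂ := fun z ↦ Function.Periodic.qParam 1 z
    have hq0 : ∀ z, q z ≠ 0 := fun z ↦ Complex.exp_ne_zero _
    let g : ℍ → ℂ := fun z ↦ (EisensteinSeries.E2 z - 1) / q z
    have hg : IsBoundedAtImInfty g := by
      refine isBoundedAtImInfty_of_hasSum_qExpansion (h := 1)
        (c := fun m ↦ -24 * (ArithmeticFunction.sigma 1 (m + 1) : ℂ)) one_pos fun z ↦ ?_
      have h1 := (hasSum_nat_add_iff' 1).mpr (EisensteinSeries.hasSum_qExpansion_E2 z)
      have h2 := h1.div_const (q z)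
      have hqz : cexp (2 * π * I * z) = q z := by
        simp [q, Function.Periodic.qParam]
      simp only [hqz, Finset.sum_range_one, pow_zero, if_true, smul_eq_mul, mul_one] at h2
      refine h2.congr_fun fun m ↦ ?_
      have := hq0 z
      simp only [Nat.succ_ne_zero, if_false, smul_eq_mul]
      rw [pow_succ]
      field_simp
      rfl
    have h3 : Tendsto (fun z ↦ g z * q z) atImInfty (𝓝 0) :=
      Filter.BoundedAtFilter.mul_zeroAtFilter hg (qParam_tendsto_atImInfty one_pos)
    have h4 := h3.add_const 1
    rw [zero_add] at h4
    refine h4.congr fun z ↦ ?_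
    rw [div_mul_cancel₀ _ (hq0 z), sub_add_cancel]
  exact h.comp tendsto_comap_im_ofComplex

/-! ### Identities between theta constants and Eisenstein series -/

theorem jacobi_identity {τ : ℂ} (hτ : 0 < τ.im) : A₃ τ = A₂ τ + A₄ τ := by
  have h : A₂ τ + A₄ τ - A₃ τ = 0 :=
    eq_zero_of_level_one_character (f := fun τ ↦ A₂ τ + A₄ τ - A₃ τ) (k := 2) (ε := -1) (by norm_num)
      (by norm_num) ((differentiableOn_A₂.add differentiableOn_A₄).sub differentiableOn_A₃)
      (fun τ hτ ↦ by simp only [A₂_neg_one_div hτ, A₃_neg_one_div hτ, A₄_neg_one_div hτ]; ring)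
      (fun τ hτ ↦ by simp only [A₂_add_one hτ, A₃_add_one, A₄_add_one]; ring)
      (by simpa using (tendsto_A₂.add tendsto_A₄).sub tendsto_A₃) hτ
  linear_combination -h

theorem deriv_neg_one_div_of_weight_two {f g : ℂ → ℂ} (hf : DifferentiableOn ℂ f {τ | 0 < τ.im})
    (hg : DifferentiableOn ℂ g {τ | 0 < τ.im})
    (h : ∀ τ : ℂ, 0 < τ.im → f (-1 / τ) = -τ ^ 2 * g τ) {τ : ℂ} (hτ : 0 < τ.im) :
    deriv f (-1 / τ) = -τ ^ 4 * deriv g τ - 2 * τ ^ 3 * g τ := by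
  have h1 : HasDerivAt (fun z : ℂ ↦ -z ^ 2 * g z)
      (-(2 * τ) * g τ + -τ ^ 2 * deriv g τ) τ := by
    simpa using! ((hasDerivAt_pow 2 τ).neg).mul (hasDerivAt_of_differentiableOn hg hτ)
  rw [deriv_neg_one_div hf h hτ h1]
  ring

/-- The logarithmic derivatives of the fourth powers. The three differences, with the sign of the one
for `A₃` reversed, form a permuted triple of weight four with `ε = -1`. -/
theorem deriv_theta_fourth_powers {τ : ℂ} (hτ : 0 < τ.im) :
    deriv A₃ τ = 2 * π * I / 6 * A₃ τ * (e₂ τ + A₂ τ - A₄ τ) ∧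
    deriv A₄ τ = 2 * π * I / 6 * A₄ τ * (e₂ τ - A₂ τ - A₃ τ) ∧
    deriv A₂ τ = 2 * π * I / 6 * A₂ τ * (e₂ τ + A₃ τ + A₄ τ) := by
  have hc := two_pi_I_ne_zero
  have d2 := differentiableOn_A₂
  have d3 := differentiableOn_A₃
  have d4 := differentiableOn_A₄
  have de := differentiableOn_e₂
  have t2 := tendsto_deriv_zero_of_tendsto d2 tendsto_A₂
  have t3 := tendsto_deriv_zero_of_tendsto d3 tendsto_A₃
  have t4 := tendsto_deriv_zero_of_tendsto d4 tendsto_A₄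
  obtain ⟨h3, h4, h2⟩ := eq_zero_of_permuted_triple
    (a := fun τ ↦ -(deriv A₃ τ - 2 * π * I / 6 * (A₃ τ * (e₂ τ + A₂ τ - A₄ τ))))
    (b := fun τ ↦ deriv A₄ τ - 2 * π * I / 6 * (A₄ τ * (e₂ τ - A₂ τ - A₃ τ)))
    (c := fun τ ↦ deriv A₂ τ - 2 * π * I / 6 * (A₂ τ * (e₂ τ + A₃ τ + A₄ τ)))
    (k := 4) (ε := -1) (by norm_num) (by norm_num)
    ((differentiableOn_deriv d3).sub ((d3.mul ((de.add d2).sub d4)).const_mul _)).neg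
    ((differentiableOn_deriv d4).sub ((d4.mul ((de.sub d2).sub d3)).const_mul _))
    ((differentiableOn_deriv d2).sub ((d2.mul ((de.add d3).add d4)).const_mul _))
    (fun τ hτ ↦ by
      simp only [deriv_neg_one_div_of_weight_two d3 d3 (fun _ ↦ A₃_neg_one_div) hτ,
        e₂_neg_one_div hτ, A₂_neg_one_div hτ, A₃_neg_one_div hτ, A₄_neg_one_div hτ]
      field_simp
      ring)
    (fun τ hτ ↦ by
      simp only [deriv_neg_one_div_of_weight_two d4 d2 (fun _ ↦ A₄_neg_one_div) hτ,
        e₂_neg_one_div hτ, A₂_neg_one_div hτ, A₃_neg_one_div hτ, A₄_neg_one_div hτ]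
      field_simp
      ring)
    (fun τ hτ ↦ by
      simp only [deriv_neg_one_div_of_weight_two d2 d4 (fun _ ↦ A₂_neg_one_div) hτ,
        e₂_neg_one_div hτ, A₂_neg_one_div hτ, A₃_neg_one_div hτ, A₄_neg_one_div hτ]
      field_simp
      ring)
    (fun τ hτ ↦ by
      simp only [deriv_add_one (ε := 1) (f := A₃) (g := A₄) (fun τ _ ↦ by rw [A₃_add_one, one_mul]) hτ,
        e₂_add_one hτ, A₂_add_one hτ, A₃_add_one, A₄_add_one]
      ring)
    (fun τ hτ ↦ by
      simp only [deriv_add_one (ε := 1) (f := A₄) (g := A₃) (fun τ _ ↦ by rw [A₄_add_one, one_mul]) hτ,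
        e₂_add_one hτ, A₂_add_one hτ, A₃_add_one, A₄_add_one]
      ring)
    (fun τ hτ ↦ by
      simp only [deriv_add_one (ε := -1) (f := A₂) (g := A₂)
        (fun τ hτ ↦ by rw [A₂_add_one hτ, neg_one_mul]) hτ,
        e₂_add_one hτ, A₂_add_one hτ, A₃_add_one, A₄_add_one]
      ring)
    (by simpa using
      (t3.sub ((tendsto_A₃.mul ((tendsto_e₂.add tendsto_A₂).sub tendsto_A₄)).const_mul
        (2 * π * I / 6))).neg)
    (by simpa using
      t4.sub ((tendsto_A₄.mul ((tendsto_e₂.sub tendsto_A₂).sub tendsto_A₃)).const_mul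
        (2 * π * I / 6)))
    (by simpa using
      t2.sub ((tendsto_A₂.mul ((tendsto_e₂.add tendsto_A₃).add tendsto_A₄)).const_mul
        (2 * π * I / 6))) hτ
  exact ⟨by linear_combination -h3, by linear_combination h4, by linear_combination h2⟩

/-- Ramanujan's differential equation for `E₂`; the difference of the two sides is of level one and
weight four, because `A₂² + A₃² + A₄²` is. -/
theorem deriv_e₂ {τ : ℂ} (hτ : 0 < τ.im) :
    deriv e₂ τ = 2 * π * I / 24 * (2 * e₂ τ ^ 2 - (A₂ τ ^ 2 + A₃ τ ^ 2 + A₄ τ ^ 2)) := by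
  have hc := two_pi_I_ne_zero
  have d2 := differentiableOn_A₂
  have d3 := differentiableOn_A₃
  have d4 := differentiableOn_A₄
  have de := differentiableOn_e₂
  have h := eq_zero_of_level_one_character
    (f := fun τ ↦ deriv e₂ τ -
      2 * π * I / 24 * (2 * e₂ τ ^ 2 - (A₂ τ ^ 2 + A₃ τ ^ 2 + A₄ τ ^ 2)))
    (k := 4) (ε := 1) (by norm_num) (by norm_num)
    ((differentiableOn_deriv de).sub ((((de.pow 2).const_mul 2).sub
      (((d2.pow 2).add (d3.pow 2)).add (d4.pow 2))).const_mul _))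
    (fun τ hτ ↦ by
      have h1 : HasDerivAt (fun z : ℂ ↦ z ^ 2 * e₂ z + 12 * z / (2 * π * I))
          (2 * τ * e₂ τ + τ ^ 2 * deriv e₂ τ + 12 / (2 * π * I)) τ := by
        simpa using! ((hasDerivAt_pow 2 τ).mul (hasDerivAt_of_differentiableOn de hτ)).add
          (((hasDerivAt_id τ).const_mul 12).div_const (2 * π * I))
      simp only [deriv_neg_one_div de (fun _ ↦ e₂_neg_one_div) hτ h1,
        e₂_neg_one_div hτ, A₂_neg_one_div hτ, A₃_neg_one_div hτ, A₄_neg_one_div hτ]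
      field_simp
      ring)
    (fun τ hτ ↦ by
      simp only [deriv_add_one (ε := 1) (f := e₂) (g := e₂)
        (fun τ hτ ↦ by rw [e₂_add_one hτ, one_mul]) hτ,
        e₂_add_one hτ, A₂_add_one hτ, A₃_add_one, A₄_add_one]
      ring)
    (by
      have := (tendsto_deriv_zero_of_tendsto de tendsto_e₂).sub
        ((((tendsto_e₂.pow 2).const_mul 2).sub (((tendsto_A₂.pow 2).add
          (tendsto_A₃.pow 2)).add (tendsto_A₄.pow 2))).const_mul (2 * π * I / 24))
      convert this using 2
      norm_num) hτ
  linear_combination h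

theorem im_half_pos {τ : ℂ} (hτ : 0 < τ.im) : 0 < (τ / 2).im := by
  rw [Complex.div_ofNat_im]; positivity

theorem im_two_mul_pos {τ : ℂ} (hτ : 0 < τ.im) : 0 < (2 * τ).im := by
  simpa using hτ

theorem e₂_half_neg_one_div {τ : ℂ} (hτ : 0 < τ.im) :
    e₂ (-1 / τ / 2) = 4 * τ ^ 2 * e₂ (2 * τ) + 24 * τ / (2 * π * I) := by
  have h0 := ne_zero_of_im_pos hτ
  rw [show -1 / τ / 2 = -1 / (2 * τ) by field_simp, e₂_neg_one_div (im_two_mul_pos hτ)]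
  ring

theorem e₂_two_mul_neg_one_div {τ : ℂ} (hτ : 0 < τ.im) :
    e₂ (2 * (-1 / τ)) = τ ^ 2 / 4 * e₂ (τ / 2) + 6 * τ / (2 * π * I) := by
  have h0 := ne_zero_of_im_pos hτ
  rw [show 2 * (-1 / τ) = -1 / (τ / 2) by field_simp, e₂_neg_one_div (im_half_pos hτ)]
  ring

/-- With `v = (-1/τ + 1)/2` and `p = (τ - 1)/2` one has `-1/v + 2 = -1/p`, so that the
transformation law of `e₂` at `v` and at `p` gives the value at `v`. -/
theorem e₂_half_add_one_neg_one_div {τ : ℂ} (hτ : 0 < τ.im) :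
    e₂ ((-1 / τ + 1) / 2) = τ ^ 2 * e₂ ((τ + 1) / 2) + 24 * τ / (2 * π * I) := by
  have h0 := ne_zero_of_im_pos hτ
  have hp : 0 < ((τ - 1) / 2).im := im_half_pos (by simpa using hτ)
  have hv : 0 < ((-1 / τ + 1) / 2).im := im_half_pos (im_add_one_pos (im_neg_one_div_pos hτ))
  have h1 : τ - 1 ≠ 0 := by
    intro h
    rw [h] at hp
    simp at hp
  have hper : e₂ ((τ + 1) / 2) = e₂ ((τ - 1) / 2) := by
    rw [← e₂_add_one hp]
    congr 1
    ring
  have hw := im_neg_one_div_pos hv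
  have hs : -1 / ((-1 / τ + 1) / 2) + 1 + 1 = -1 / ((τ - 1) / 2) := by
    have : -1 + τ ≠ 0 := by rwa [neg_add_eq_sub]
    field_simp
    ring
  have h := e₂_neg_one_div hp
  rw [← hs, e₂_add_one (im_add_one_pos hw), e₂_add_one hw, e₂_neg_one_div hv] at h
  rw [hper]
  have hc := two_pi_I_ne_zero
  have hv' : (-1 / τ + 1) / 2 = (τ - 1) / (2 * τ) := by
    field_simp
    ring
  rw [hv'] at h ⊢
  generalize e₂ ((τ - 1) / (2 * τ)) = u at h ⊢
  generalize e₂ ((τ - 1) / 2) = v at h ⊢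
  generalize (2 * π * I : ℂ) = c at h hc ⊢
  field_simp at h
  have hcc : c * (24 * τ / c) = 24 * τ := by field_simp
  refine mul_left_cancel₀ (mul_ne_zero h1 hc) ?_
  linear_combination h - (τ - 1) * hcc

/-- The first of three relations between the values of `E₂` at `τ`, `τ/2`, `(τ + 1)/2`, `2τ`, whose
differences form a permuted triple of weight two with `ε = 1`. -/
theorem e₂_isogeny_relation {τ : ℂ} (hτ : 0 < τ.im) :
    e₂ (τ / 2) + 4 * e₂ (2 * τ) - 4 * e₂ τ = A₄ τ - A₂ τ := by
  have hc := two_pi_I_ne_zero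
  have d2 := differentiableOn_A₂
  have d3 := differentiableOn_A₃
  have d4 := differentiableOn_A₄
  have de := differentiableOn_e₂
  have dh : DifferentiableOn ℂ (fun τ ↦ e₂ (τ / 2)) {τ | 0 < τ.im} :=
    de.comp (by fun_prop) fun _ h ↦ im_half_pos h
  have dh1 : DifferentiableOn ℂ (fun τ ↦ e₂ ((τ + 1) / 2)) {τ | 0 < τ.im} :=
    de.comp (by fun_prop) fun _ h ↦ im_half_pos (im_add_one_pos h)
  have dd : DifferentiableOn ℂ (fun τ ↦ e₂ (2 * τ)) {τ | 0 < τ.im} :=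
    de.comp (by fun_prop) fun _ h ↦ im_two_mul_pos h
  have lh : Tendsto (fun τ : ℂ ↦ τ / 2) (comap im atTop) (comap im atTop) := by
    rw [tendsto_comap_iff]
    exact (tendsto_comap.atTop_div_const (r := (2 : ℝ)) two_pos).congr fun τ ↦ by simp
  have ld : Tendsto (fun τ : ℂ ↦ 2 * τ) (comap im atTop) (comap im atTop) := by
    rw [tendsto_comap_iff]
    exact (tendsto_comap.const_mul_atTop (r := (2 : ℝ)) two_pos).congr fun τ ↦ by simp
  have th : Tendsto (fun τ ↦ e₂ (τ / 2)) (comap im atTop) (𝓝 1) := tendsto_e₂.comp lh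
  have th1 : Tendsto (fun τ ↦ e₂ ((τ + 1) / 2)) (comap im atTop) (𝓝 1) := th.comp tendsto_add_one
  have td : Tendsto (fun τ ↦ e₂ (2 * τ)) (comap im atTop) (𝓝 1) := tendsto_e₂.comp ld
  have p1 : ∀ τ : ℂ, 0 < τ.im → e₂ ((τ + 1 + 1) / 2) = e₂ (τ / 2) := fun τ hτ ↦ by
    rw [← e₂_add_one (im_half_pos hτ)]
    congr 1
    ring
  have p2 : ∀ τ : ℂ, 0 < τ.im → e₂ (2 * (τ + 1)) = e₂ (2 * τ) := fun τ hτ ↦ by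
    rw [show 2 * (τ + 1) = 2 * τ + 1 + 1 by ring, e₂_add_one (im_add_one_pos (im_two_mul_pos hτ)),
      e₂_add_one (im_two_mul_pos hτ)]
  obtain ⟨h, -, -⟩ := eq_zero_of_permuted_triple
    (a := fun τ ↦ e₂ (τ / 2) + 4 * e₂ (2 * τ) - 4 * e₂ τ - A₄ τ + A₂ τ)
    (b := fun τ ↦ e₂ ((τ + 1) / 2) + 4 * e₂ (2 * τ) - 4 * e₂ τ - A₃ τ - A₂ τ)
    (c := fun τ ↦ e₂ (τ / 2) + e₂ ((τ + 1) / 2) - 4 * e₂ τ + A₃ τ + A₄ τ)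
    (k := 2) (ε := 1) (by norm_num) (by norm_num)
    ((((dh.add (dd.const_mul 4)).sub (de.const_mul 4)).sub d4).add d2)
    ((((dh1.add (dd.const_mul 4)).sub (de.const_mul 4)).sub d3).sub d2)
    ((((dh.add dh1).sub (de.const_mul 4)).add d3).add d4)
    (fun τ hτ ↦ by
      simp only [e₂_half_neg_one_div hτ, e₂_two_mul_neg_one_div hτ, e₂_neg_one_div hτ,
        A₂_neg_one_div hτ, A₄_neg_one_div hτ]
      ring)
    (fun τ hτ ↦ by
      simp only [e₂_half_add_one_neg_one_div hτ, e₂_two_mul_neg_one_div hτ, e₂_neg_one_div hτ,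
        A₂_neg_one_div hτ, A₃_neg_one_div hτ]
      ring)
    (fun τ hτ ↦ by
      simp only [e₂_half_neg_one_div hτ, e₂_half_add_one_neg_one_div hτ, e₂_neg_one_div hτ,
        A₃_neg_one_div hτ, A₄_neg_one_div hτ]
      ring)
    (fun τ hτ ↦ by
      simp only [p2 τ hτ, e₂_add_one hτ, A₂_add_one hτ, A₄_add_one]
      ring)
    (fun τ hτ ↦ by
      simp only [p1 τ hτ, p2 τ hτ, e₂_add_one hτ, A₂_add_one hτ, A₃_add_one]
      ring)
    (fun τ hτ ↦ by
      simp only [p1 τ hτ, e₂_add_one hτ, A₃_add_one, A₄_add_one]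
      ring)
    (by
      have := (((th.add (td.const_mul 4)).sub (tendsto_e₂.const_mul 4)).sub tendsto_A₄).add tendsto_A₂
      convert this using 2
      norm_num)
    (by
      have := (((th1.add (td.const_mul 4)).sub (tendsto_e₂.const_mul 4)).sub tendsto_A₃).sub
        tendsto_A₂
      convert this using 2
      norm_num)
    (by
      have := (((th.add th1).sub (tendsto_e₂.const_mul 4)).add tendsto_A₃).add tendsto_A₄
      convert this using 2
      norm_num) hτ
  linear_combination h

/-! ### The differential equations in the half-plane `Re t < 0` -/

/-- A differential equation for `g ^ 4` gives one for `g`, whether or not `g` has zeros. -/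
theorem four_mul_deriv_eq {g h₁ : ℂ → ℂ} (hg : DifferentiableOn ℂ g {τ | 0 < τ.im})
    (hh : DifferentiableOn ℂ h₁ {τ | 0 < τ.im}) (hne : ∃ τ : ℂ, 0 < τ.im ∧ g τ ≠ 0)
    (h4 : ∀ τ : ℂ, 0 < τ.im → deriv (fun τ ↦ g τ ^ 4) τ = g τ ^ 4 * h₁ τ) {τ : ℂ} (hτ : 0 < τ.im) :
    4 * deriv g τ = g τ * h₁ τ := by
  have hprod : ∀ τ ∈ {τ : ℂ | 0 < τ.im}, g τ ^ 3 * (4 * deriv g τ - g τ * h₁ τ) = 0 := by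
    intro τ hτ
    have h1 := h4 τ hτ
    rw [((hasDerivAt_of_differentiableOn hg hτ).fun_pow 4).deriv] at h1
    push_cast at h1
    linear_combination h1
  rcases AnalyticOnNhd.eq_zero_or_eq_zero_of_mul_eq_zero ((hg.pow 3).analyticOnNhd isOpen_im_pos)
    ((((differentiableOn_deriv hg).const_mul 4).sub (hg.mul hh)).analyticOnNhd isOpen_im_pos)
    hprod isPreconnected_im_pos with h | h
  · obtain ⟨σ, hσ, hne⟩ := hne
    exact absurd (pow_eq_zero_iff three_ne_zero |>.mp (h σ hσ)) hne
  · have h' : 4 * deriv g τ - g τ * h₁ τ = 0 := h τ hτ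
    linear_combination h'

theorem exists_ne_zero_of_tendsto_one {f : ℂ → ℂ} (h : Tendsto f (comap im atTop) (𝓝 1)) :
    ∃ τ : ℂ, 0 < τ.im ∧ f τ ≠ 0 := by
  have : (comap im atTop).NeBot := comap_neBot fun t ht ↦ by
    obtain ⟨y, hy⟩ := nonempty_of_mem ht
    exact ⟨y * I, by simpa using hy⟩
  have hpos : ∀ᶠ τ : ℂ in comap im atTop, 0 < τ.im := preimage_mem_comap (Ioi_mem_atTop 0)
  exact (hpos.and (h.eventually_ne one_ne_zero)).exists

theorem deriv_jacobiTheta {τ : ℂ} (hτ : 0 < τ.im) :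
    4 * deriv jacobiTheta τ = jacobiTheta τ * (2 * π * I / 6 * (e₂ τ + A₂ τ - A₄ τ)) :=
  four_mul_deriv_eq (h₁ := fun τ ↦ 2 * π * I / 6 * (e₂ τ + A₂ τ - A₄ τ)) differentiableOn_jacobiTheta
    (((differentiableOn_e₂.add differentiableOn_A₂).sub differentiableOn_A₄).const_mul _)
    (exists_ne_zero_of_tendsto_one tendsto_jacobiTheta)
    (fun τ hτ ↦ (deriv_theta_fourth_powers hτ).1.trans (by rw [A₃]; ring)) hτ

theorem deriv_theta2 {τ : ℂ} (hτ : 0 < τ.im) :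
    4 * deriv (fun τ ↦ theta2 (2 * π * I * τ)) τ =
      theta2 (2 * π * I * τ) * (2 * π * I / 6 * (e₂ τ + A₃ τ + A₄ τ)) := by
  refine four_mul_deriv_eq (g := fun τ ↦ theta2 (2 * π * I * τ))
    (h₁ := fun τ ↦ 2 * π * I / 6 * (e₂ τ + A₃ τ + A₄ τ)) differentiableOn_theta2
    (((differentiableOn_e₂.add differentiableOn_A₃).add differentiableOn_A₄).const_mul _) ?_
    (fun τ hτ ↦ (deriv_theta_fourth_powers hτ).2.2.trans (by rw [A₂]; ring)) hτ
  -- `A₂` is not identically zero, since `τ ↦ -1/τ` carries it to `A₄`, which tends to one.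
  obtain ⟨σ, hσ, hne⟩ := exists_ne_zero_of_tendsto_one tendsto_A₄
  refine ⟨-1 / σ, im_neg_one_div_pos hσ, fun h ↦ hne ?_⟩
  have h2 := A₂_neg_one_div hσ
  rw [A₂, h, zero_pow four_ne_zero] at h2
  exact (mul_eq_zero.mp h2.symm).resolve_left
    (neg_ne_zero.mpr (pow_ne_zero 2 (ne_zero_of_im_pos hσ)))

/-- The period `τ` with `q ^ 8 = exp (2 π i τ)`, where `q = exp t`. -/
noncomputable def period (t : ℂ) : ℂ := 8 * t / (2 * π * I)

theorem im_period_pos {t : ℂ} (ht : t.re < 0) : 0 < (period t).im := by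
  have hpi := Real.pi_pos
  have : period t = ((4 / π : ℝ) : ℂ) * (-(t * I)) := by
    have : (π : ℂ) ≠ 0 := by exact_mod_cast hpi.ne'
    rw [period]
    push_cast
    field_simp
    linear_combination (8 * t) * I_sq
  rw [this, im_ofReal_mul, neg_im, mul_I_im]
  have h4 : 0 < 4 / π := by positivity
  exact mul_pos h4 (by linarith)

theorem two_pi_I_mul_period (t : ℂ) : 2 * π * I * period t = 8 * t := by
  have := two_pi_I_ne_zero
  rw [period]
  field_simp

theorem hasDerivAt_period (t : ℂ) : HasDerivAt period (8 / (2 * π * I)) t := by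
  simpa [period] using! ((hasDerivAt_id t).const_mul 8).div_const (2 * π * I)

theorem x_eq {t : ℂ} (ht : t.re < 0) : x t = jacobiTheta (period t) ^ 2 := by
  rw [x, ← two_pi_I_mul_period, theta3_eq_jacobiTheta (im_period_pos ht)]

theorem y_eq (t : ℂ) : y t = theta2 (2 * π * I * period t) ^ 2 := by
  rw [y, two_pi_I_mul_period]

theorem w_eq {t : ℂ} (ht : t.re < 0) :
    w t = 1 / 3 * (2 * e₂ (period t) + A₄ (period t) - A₂ (period t)) := by
  have h := im_period_pos ht
  have h1 : eisF (4 * t) = e₂ (period t / 2) := by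
    rw [← eisF_eq_e₂ (im_half_pos h)]
    congr 1
    linear_combination -(1 / 2) * two_pi_I_mul_period t
  have h2 : eisF (8 * t) = e₂ (period t) := by
    rw [← eisF_eq_e₂ h, two_pi_I_mul_period]
  have h3 : eisF (16 * t) = e₂ (2 * period t) := by
    rw [← eisF_eq_e₂ (im_two_mul_pos h)]
    congr 1
    linear_combination -2 * two_pi_I_mul_period t
  rw [w, h1, h2, h3]
  linear_combination 1 / 3 * e₂_isogeny_relation h

theorem isOpen_re_neg : IsOpen {t : ℂ | t.re < 0} := isOpen_lt continuous_re continuous_const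

theorem isSolutionOn_re_neg : IsSolutionOn {t : ℂ | t.re < 0} x y w := by
  intro t ht
  have hc := two_pi_I_ne_zero
  have hT := im_period_pos ht
  have hx2 : x t ^ 2 = A₃ (period t) := by rw [x_eq ht, A₃]; ring
  have hy2 : y t ^ 2 = A₂ (period t) := by rw [y_eq, A₂]; ring
  have hx4 : x t ^ 4 = A₃ (period t) ^ 2 := by rw [← hx2]; ring
  have hJ := jacobi_identity hT
  obtain ⟨-, h4, h2⟩ := deriv_theta_fourth_powers hT
  rw [hx2, hx4, hy2, w_eq ht]
  have hnhds := isOpen_re_neg.mem_nhds ht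
  have hp := hasDerivAt_period t
  refine ⟨?_, ?_, ?_⟩
  · have hd := ((hasDerivAt_of_differentiableOn differentiableOn_jacobiTheta hT).comp t hp).fun_pow 2
    refine (hd.congr_of_eventuallyEq ?_).congr_deriv ?_
    · filter_upwards [hnhds] with s hs using x_eq hs
    · have h := deriv_jacobiTheta hT
      have h' : deriv jacobiTheta (period t) =
        jacobiTheta (period t) * (2 * π * I / 24 *
          (e₂ (period t) + A₂ (period t) - A₄ (period t))) := by linear_combination h / 4
      rw [h', x_eq ht, hJ]
      simp only [Function.comp_apply]
      field_simp
      push_cast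
      ring
  · have hd := ((hasDerivAt_of_differentiableOn differentiableOn_theta2 hT).comp t hp).fun_pow 2
    refine (hd.congr_of_eventuallyEq (.of_forall fun s ↦ y_eq s)).congr_deriv ?_
    have h := deriv_theta2 hT
    have h' : deriv (fun τ ↦ theta2 (2 * π * I * τ)) (period t) =
        theta2 (2 * π * I * period t) * (2 * π * I / 24 *
          (e₂ (period t) + A₃ (period t) + A₄ (period t))) := by linear_combination h / 4
    rw [h', y_eq, hJ]
    simp only [Function.comp_apply]
    field_simp
    push_cast
    ring
  · have hd := ((((hasDerivAt_of_differentiableOn differentiableOn_e₂ hT).const_mul 2).add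
      (hasDerivAt_of_differentiableOn differentiableOn_A₄ hT)).sub
      (hasDerivAt_of_differentiableOn differentiableOn_A₂ hT)).const_mul (1 / 3) |>.comp t hp
    refine (hd.congr_of_eventuallyEq ?_).congr_deriv ?_
    · filter_upwards [hnhds] with s hs using w_eq hs
    · rw [h4, h2, deriv_e₂ hT, hJ]
      field_simp
      ring

theorem differentiableOn_z : DifferentiableOn ℂ z {t : ℂ | t.re < 0} := by
  have hz : z = fun t ↦ theta2 (2 * π * I * period (t / 2)) ^ 2 := by
    ext t
    rw [z, two_pi_I_mul_period]
    congr 2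
    ring
  rw [hz]
  have hp : Differentiable ℂ period := fun t ↦ (hasDerivAt_period t).differentiableAt
  refine (differentiableOn_theta2.comp (f := fun t ↦ period (t / 2)) (by fun_prop)
    fun t ht ↦ im_period_pos ?_).pow 2
  rw [Complex.div_ofNat_re]
  exact div_neg_of_neg_of_pos ht two_pos

/-! ### The action of `SL(2, ℂ)` on solutions -/

section Action

variable (A : Matrix.SpecialLinearGroup (Fin 2) ℂ)

/-- Derivatives of the two actions, with the contributions of `(c t + d)⁻¹` expressed through the
actions themselves. -/
theorem hasDerivAt_act {F : ℂ → ℂ} {F' t : ℂ} (ht : A 1 0 * t + A 1 1 ≠ 0)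
    (hF : HasDerivAt F F' ((A 0 0 * t + A 0 1) / (A 1 0 * t + A 1 1))) :
    HasDerivAt (act A F) (1 / (A 1 0 * t + A 1 1) ^ 3 * F' -
      A 1 0 / (A 1 0 * t + A 1 1) * act A F t) t ∧
    HasDerivAt (actW A F) (1 / (A 1 0 * t + A 1 1) ^ 4 * F' -
      2 * (A 1 0 / (A 1 0 * t + A 1 1)) * actW A F t - (A 1 0 / (A 1 0 * t + A 1 1)) ^ 2) t := by
  have hdet : A 0 0 * A 1 1 - A 0 1 * A 1 0 = 1 := by
    rw [← Matrix.det_fin_two, A.det_coe]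
  have hden : HasDerivAt (fun t ↦ A 1 0 * t + A 1 1) (A 1 0) t := by
    simpa using ((hasDerivAt_id t).const_mul (A 1 0)).add_const (A 1 1)
  have hnum : HasDerivAt (fun t ↦ A 0 0 * t + A 0 1) (A 0 0) t := by
    simpa using ((hasDerivAt_id t).const_mul (A 0 0)).add_const (A 0 1)
  have hg : HasDerivAt (fun t ↦ (A 0 0 * t + A 0 1) / (A 1 0 * t + A 1 1))
      (1 / (A 1 0 * t + A 1 1) ^ 2) t := by
    refine (hnum.fun_div hden ht).congr_deriv ?_
    congr 1
    linear_combination hdet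
  have hFg := hF.comp t hg
  constructor
  · refine (((hasDerivAt_const t (1 : ℂ)).fun_div hden ht).mul hFg).congr_deriv ?_
    simp only [act, Function.comp_apply]
    field_simp
    ring
  · refine ((((hasDerivAt_const t (1 : ℂ)).fun_div (hden.fun_pow 2) (pow_ne_zero 2 ht)).mul hFg).sub
      ((hasDerivAt_const t (A 1 0)).fun_div hden ht)).congr_deriv ?_
    simp only [actW, Function.comp_apply]
    field_simp
    push_cast
    ring

theorem isSolutionOn_act {U V : Set ℂ} {X Y W : ℂ → ℂ} (h : IsSolutionOn U X Y W)
    (hV : ∀ t ∈ V, A 1 0 * t + A 1 1 ≠ 0 ∧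
      (A 0 0 * t + A 0 1) / (A 1 0 * t + A 1 1) ∈ U) :
    IsSolutionOn V (act A X) (act A Y) (actW A W) := by
  intro t ht
  obtain ⟨h0, hU⟩ := hV t ht
  obtain ⟨hX, hY, hW⟩ := h _ hU
  refine ⟨(hasDerivAt_act A h0 hX).1.congr_deriv ?_, (hasDerivAt_act A h0 hY).1.congr_deriv ?_,
    (hasDerivAt_act A h0 hW).2.congr_deriv ?_⟩ <;>
  · simp only [act, actW]
    field_simp
    ring

end Action

theorem IsSolutionOn.congr {U : Set ℂ} {X Y W X' Y' W' : ℂ → ℂ} (h : IsSolutionOn U X Y W)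
    (hU : IsOpen U) (hX : ∀ t ∈ U, X' t = X t) (hY : ∀ t ∈ U, Y' t = Y t)
    (hW : ∀ t ∈ U, W' t = W t) : IsSolutionOn U X' Y' W' := by
  intro t ht
  rw [hX t ht, hY t ht, hW t ht]
  obtain ⟨h1, h2, h3⟩ := h t ht
  exact ⟨h1.congr_of_eventuallyEq (eventuallyEq_of_mem (hU.mem_nhds ht) hX),
    h2.congr_of_eventuallyEq (eventuallyEq_of_mem (hU.mem_nhds ht) hY),
    h3.congr_of_eventuallyEq (eventuallyEq_of_mem (hU.mem_nhds ht) hW)⟩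

/-! ### The Cayley transform of the disc -/

section Cayley

variable {κ : ℂ} {τ₀ : UpperHalfPlane} {ω₀ : ℂ}

theorem isOpen_disc : IsOpen (disc τ₀ ω₀) := isOpen_lt continuous_norm continuous_const

theorem den_ne_zero {τ : ℂ} (hτ : τ ∈ disc τ₀ ω₀) : den τ₀ ω₀ τ ≠ 0 := by
  intro h
  have h' : τ = I * (2 * ω₀ ^ 2 * (τ₀.im : ℂ)) := by
    rw [den] at h
    linear_combination -h
  have : ‖τ‖ < ‖2 * ω₀ ^ 2 * (τ₀.im : ℂ)‖ := hτ
  rw [h', norm_mul, norm_I, one_mul] at this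
  exact lt_irrefl _ this

/-- For `m = 2 i ω₀² Im τ₀` the imaginary part of the transformed point is
`Im τ₀ (|m|² - |τ|²) / |m - τ|²`. -/
theorem im_cayleyPoint_pos {τ : ℂ} (hτ : τ ∈ disc τ₀ ω₀) : 0 < (cayleyPoint τ₀ ω₀ τ).im := by
  have hd := normSq_pos.mpr (den_ne_zero hτ)
  set m : ℂ := 2 * I * ω₀ ^ 2 * (τ₀.im : ℂ) with hm
  have hlt : normSq τ < normSq m := by
    have h : ‖τ‖ < ‖m‖ := by
      have : m = I * (2 * ω₀ ^ 2 * (τ₀.im : ℂ)) := by rw [hm]; ring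
      rw [this, norm_mul, norm_I, one_mul]
      exact hτ
    rw [normSq_eq_norm_sq, normSq_eq_norm_sq]
    exact pow_lt_pow_left₀ h (norm_nonneg _) two_ne_zero
  have hden : den τ₀ ω₀ τ = m - τ := rfl
  have heq : cayleyPoint τ₀ ω₀ τ = (m * τ₀ - (starRingEnd ℂ) (τ₀ : ℂ) * τ) / (m - τ) := by
    rw [cayleyPoint, hden]
    congr 2
    rw [hm]
    ring
  rw [hden] at hd
  have hy := τ₀.im_pos
  have him : (cayleyPoint τ₀ ω₀ τ).im = τ₀.im * (normSq m - normSq τ) / normSq (m - τ) := by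
    rw [heq, Complex.div_im]
    simp only [normSq_apply, sub_re, sub_im, mul_re, mul_im, conj_re, conj_im, coe_re, coe_im]
    rw [← sub_div]
    congr 1
    ring
  rw [him]
  exact div_pos (mul_pos hy (sub_pos.mpr hlt)) hd

theorem kappa_ne_zero (hκ : κ ^ 2 = 2 * (π : ℂ) * I / 4) : κ ≠ 0 := by
  rintro rfl
  rw [zero_pow two_ne_zero] at hκ
  exact two_pi_I_ne_zero (by linear_combination -4 * hκ)

theorem tOf_eq (hκ : κ ^ 2 = 2 * (π : ℂ) * I / 4) (τ : ℂ) : tOf τ = κ ^ 2 * τ := by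
  rw [tOf, hκ]
  ring

theorem re_tOf_neg {τ : ℂ} (hτ : 0 < τ.im) : (tOf τ).re < 0 := by
  rw [tOf, show 2 * (π : ℂ) * I * τ / 4 = ((π / 2 : ℝ) : ℂ) * (τ * I) by push_cast; ring,
    re_ofReal_mul, mul_I_re]
  have : 0 < π / 2 := by positivity
  nlinarith

theorem im_ne_zero : (τ₀.im : ℂ) ≠ 0 := by exact_mod_cast τ₀.im_pos.ne'

theorem det_matA (hκ : κ ≠ 0) (hω₀ : ω₀ ≠ 0) : (matA κ τ₀ ω₀).det = 1 := by
  have hy := im_ne_zero (τ₀ := τ₀)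
  have h := Complex.sub_conj (τ₀ : ℂ)
  rw [matA, Matrix.det_fin_two_of]
  rw [coe_im] at h
  push_cast at h
  field_simp
  linear_combination (-I) * h - 2 * (τ₀.im : ℂ) * I_sq

theorem matA_den (hκ : κ ≠ 0) (hω₀ : ω₀ ≠ 0) (τ : ℂ) :
    matA κ τ₀ ω₀ 1 0 * τ + matA κ τ₀ ω₀ 1 1 =
      den τ₀ ω₀ τ / (κ * (2 * I * ω₀ * (τ₀.im : ℂ))) := by
  have hy := im_ne_zero (τ₀ := τ₀)
  simp only [matA, den, Matrix.of_apply, Matrix.cons_val', Matrix.cons_val_zero,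
    Matrix.cons_val_one, Matrix.cons_val_fin_one]
  field_simp
  linear_combination τ * I_sq

theorem matA_num (hω₀ : ω₀ ≠ 0) (τ : ℂ) :
    matA κ τ₀ ω₀ 0 0 * τ + matA κ τ₀ ω₀ 0 1 =
      κ * (2 * I * ω₀ ^ 2 * (τ₀ : ℂ) * (τ₀.im : ℂ) - (starRingEnd ℂ) (τ₀ : ℂ) * τ) /
        (2 * I * ω₀ * (τ₀.im : ℂ)) := by
  have hy := im_ne_zero (τ₀ := τ₀)
  simp only [matA, Matrix.of_apply, Matrix.cons_val', Matrix.cons_val_zero,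
    Matrix.cons_val_one, Matrix.cons_val_fin_one]
  field_simp
  linear_combination κ * (starRingEnd ℂ) (τ₀ : ℂ) * τ * I_sq

theorem matA_moebius (hκ : κ ^ 2 = 2 * (π : ℂ) * I / 4) (hω₀ : ω₀ ≠ 0) {τ : ℂ}
    (hτ : τ ∈ disc τ₀ ω₀) :
    (matA κ τ₀ ω₀ 0 0 * τ + matA κ τ₀ ω₀ 0 1) / (matA κ τ₀ ω₀ 1 0 * τ + matA κ τ₀ ω₀ 1 1) =
      tOf (cayleyPoint τ₀ ω₀ τ) := by
  have hy := im_ne_zero (τ₀ := τ₀)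
  have hk := kappa_ne_zero hκ
  have hd := den_ne_zero hτ
  rw [matA_den hk hω₀, matA_num hω₀, tOf_eq hκ, cayleyPoint]
  field_simp

variable {A : Matrix.SpecialLinearGroup (Fin 2) ℂ}

theorem matA_den_ne_zero (hκ : κ ≠ 0) (hω₀ : ω₀ ≠ 0) {τ : ℂ} (hτ : τ ∈ disc τ₀ ω₀) :
    matA κ τ₀ ω₀ 1 0 * τ + matA κ τ₀ ω₀ 1 1 ≠ 0 := by
  rw [matA_den hκ hω₀]
  exact div_ne_zero (den_ne_zero hτ) (mul_ne_zero hκ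
    (mul_ne_zero (mul_ne_zero (mul_ne_zero two_ne_zero I_ne_zero) hω₀) im_ne_zero))

theorem cayley_eq_act (hκ : κ ^ 2 = 2 * (π : ℂ) * I / 4) (hω₀ : ω₀ ≠ 0)
    (hA : (A : Matrix (Fin 2) (Fin 2) ℂ) = matA κ τ₀ ω₀) (F : ℂ → ℂ) {τ : ℂ}
    (hτ : τ ∈ disc τ₀ ω₀) :
    cayley τ₀ ω₀ (fun σ ↦ κ * F (tOf σ)) τ = act A F τ := by
  have hk := kappa_ne_zero hκ
  have hy := im_ne_zero (τ₀ := τ₀)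
  have hd := den_ne_zero hτ
  simp only [act, cayley]
  rw [hA, matA_moebius hκ hω₀ hτ, matA_den hk hω₀]
  field_simp

theorem cayleyW_eq_actW (hκ : κ ^ 2 = 2 * (π : ℂ) * I / 4) (hω₀ : ω₀ ≠ 0)
    (hA : (A : Matrix (Fin 2) (Fin 2) ℂ) = matA κ τ₀ ω₀) (F : ℂ → ℂ) {τ : ℂ}
    (hτ : τ ∈ disc τ₀ ω₀) :
    cayleyW τ₀ ω₀ (fun σ ↦ κ ^ 2 * F (tOf σ)) τ = actW A F τ := by
  have hk := kappa_ne_zero hκ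
  have hy := im_ne_zero (τ₀ := τ₀)
  have hd := den_ne_zero hτ
  have h10 : matA κ τ₀ ω₀ 1 0 = -1 / (κ * (2 * I * ω₀ * (τ₀.im : ℂ))) := by
    simp only [matA, Matrix.of_apply, Matrix.cons_val', Matrix.cons_val_zero,
      Matrix.cons_val_one, Matrix.cons_val_fin_one]
    field_simp
    linear_combination I_sq
  simp only [actW, cayleyW]
  rw [hA, matA_moebius hκ hω₀ hτ, matA_den hk hω₀, h10]
  field_simp
  ring

end Cayley

end ThetaCayley

theorem mainTheorem8 (κ : ℂ) (hκ : κ ^ 2 = 2 * (Real.pi : ℂ) * Complex.I / 4)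
    (τ₀ : UpperHalfPlane) (ω₀ : ℂ) (hω₀ : ω₀ ≠ 0) :
    -- the transformed functions are defined on the disc
    (∀ τ ∈ ThetaCayley.disc τ₀ ω₀,
      ThetaCayley.den τ₀ ω₀ τ ≠ 0 ∧ 0 < (ThetaCayley.cayleyPoint τ₀ ω₀ τ).im) ∧
    -- (i) they solve the system
    ThetaCayley.IsSolutionOn (ThetaCayley.disc τ₀ ω₀)
      (ThetaCayley.cayley τ₀ ω₀ (ThetaCayley.xInf κ))
      (ThetaCayley.cayley τ₀ ω₀ (ThetaCayley.yInf κ))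
      (ThetaCayley.cayleyW τ₀ ω₀ (ThetaCayley.wInf κ)) ∧
    -- (ii) they are holomorphic on the disc
    (DifferentiableOn ℂ (ThetaCayley.cayley τ₀ ω₀ (ThetaCayley.xInf κ)) (ThetaCayley.disc τ₀ ω₀) ∧
      DifferentiableOn ℂ (ThetaCayley.cayley τ₀ ω₀ (ThetaCayley.yInf κ)) (ThetaCayley.disc τ₀ ω₀) ∧
      DifferentiableOn ℂ (ThetaCayley.cayley τ₀ ω₀ (ThetaCayley.zInf κ)) (ThetaCayley.disc τ₀ ω₀) ∧
      DifferentiableOn ℂ (ThetaCayley.cayleyW τ₀ ω₀ (ThetaCayley.wInf κ))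
        (ThetaCayley.disc τ₀ ω₀)) ∧
    -- (iii) they are given by the action of the matrix, which lies in SL(2, ℂ)
    (∃ A : Matrix.SpecialLinearGroup (Fin 2) ℂ,
      (A : Matrix (Fin 2) (Fin 2) ℂ) = ThetaCayley.matA κ τ₀ ω₀ ∧
      ∀ τ ∈ ThetaCayley.disc τ₀ ω₀,
        ThetaCayley.cayley τ₀ ω₀ (ThetaCayley.xInf κ) τ = ThetaCayley.act A ThetaCayley.x τ ∧
        ThetaCayley.cayley τ₀ ω₀ (ThetaCayley.yInf κ) τ = ThetaCayley.act A ThetaCayley.y τ ∧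
        ThetaCayley.cayley τ₀ ω₀ (ThetaCayley.zInf κ) τ = ThetaCayley.act A ThetaCayley.z τ ∧
        ThetaCayley.cayleyW τ₀ ω₀ (ThetaCayley.wInf κ) τ =
          ThetaCayley.actW A ThetaCayley.w τ) := by
  have hk := ThetaCayley.kappa_ne_zero hκ
  let A : Matrix.SpecialLinearGroup (Fin 2) ℂ :=
    ⟨ThetaCayley.matA κ τ₀ ω₀, ThetaCayley.det_matA hk hω₀⟩
  have hA : (A : Matrix (Fin 2) (Fin 2) ℂ) = ThetaCayley.matA κ τ₀ ω₀ := rfl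
  have hact : ∀ F : ℂ → ℂ, ∀ τ ∈ ThetaCayley.disc τ₀ ω₀,
      ThetaCayley.cayley τ₀ ω₀ (fun σ ↦ κ * F (ThetaCayley.tOf σ)) τ = ThetaCayley.act A F τ :=
    fun F τ hτ ↦ ThetaCayley.cayley_eq_act hκ hω₀ hA F hτ
  have hactW := fun τ hτ ↦ ThetaCayley.cayleyW_eq_actW (τ := τ) hκ hω₀ hA ThetaCayley.w hτ
  have hmem : ∀ τ ∈ ThetaCayley.disc τ₀ ω₀, A 1 0 * τ + A 1 1 ≠ 0 ∧
      (A 0 0 * τ + A 0 1) / (A 1 0 * τ + A 1 1) ∈ {t : ℂ | t.re < 0} := fun τ hτ ↦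
    ⟨ThetaCayley.matA_den_ne_zero hk hω₀ hτ, by
      have := ThetaCayley.re_tOf_neg (ThetaCayley.im_cayleyPoint_pos hτ)
      rwa [← ThetaCayley.matA_moebius hκ hω₀ hτ] at this⟩
  have hsol := (ThetaCayley.isSolutionOn_act A ThetaCayley.isSolutionOn_re_neg hmem).congr
    ThetaCayley.isOpen_disc (hact ThetaCayley.x) (hact ThetaCayley.y) hactW
  refine ⟨fun τ hτ ↦ ⟨ThetaCayley.den_ne_zero hτ, ThetaCayley.im_cayleyPoint_pos hτ⟩, hsol,
    ⟨fun τ hτ ↦ (hsol τ hτ).1.differentiableAt.differentiableWithinAt,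
      fun τ hτ ↦ (hsol τ hτ).2.1.differentiableAt.differentiableWithinAt, ?_,
      fun τ hτ ↦ (hsol τ hτ).2.2.differentiableAt.differentiableWithinAt⟩,
    A, hA, fun τ hτ ↦ ⟨hact _ τ hτ, hact _ τ hτ, hact _ τ hτ, hactW τ hτ⟩⟩
  refine DifferentiableOn.congr (fun τ hτ ↦ ?_) (hact ThetaCayley.z)
  obtain ⟨h0, hre⟩ := hmem τ hτ
  exact (ThetaCayley.hasDerivAt_act A h0 (ThetaCayley.differentiableOn_z.differentiableAt
    (ThetaCayley.isOpen_re_neg.mem_nhds hre)).hasDerivAt).1.differentiableAt.differentiableWithinAt
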